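/- Let $\mathcal H=L^2(\mathbb R)$, and for $q,p\in\mathbb R$ let $[U(q)\psi](x)=\psi(x-q)$ and $[V(p)\psi](x)=e^{ipx}\psi(x)$. An observable on $\mathbb R$ is a map $E$ from the Borel sets of $\mathbb R$ to the bounded operators on $\mathcal H$ with $E(X)\ge 0$, $E(\mathbb R)=I$, which is $\sigma$-additive in the weak operator topology. An observable $E$ is a position observable if, for all $q,p\in\mathbb R$ and all Borel $X$, $$U(q)E(X)U(q)^*=E(X+q),\qquad V(p)E(X)V(p)^*=E(X),$$ and an observable $F$ is a momentum observable if, for all $q,p\in\mathbb R$ and all Borel $Y$, $$V(p)F(Y)V(p)^*=F(Y+p),\qquad U(q)F(Y)U(q)^*=F(Y).$$ The commutation domain of $E$ and $F$ is $$\mathrm{com}(E,F)=\{\psi\in\mathcal H \mid E(X)F(Y)\psi-F(Y)E(X)\psi=0\ \text{ for all Borel } X,Y\subseteq\mathbb R\}.$$ Then every position observable $E$ and every momentum observable $F$ are totally noncommutative, that is, $\mathrm{com}(E,F)=\{0\}$. In particular, for all Borel probability measures $\rho,\nu$ on $\mathbb R$, $\mathrm{com}(E_\rho,F_\nu)=\{0\}$,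 where $$E_\rho(X)=\int\rho(X-q)\,d\Pi_Q(q),\qquad F_\nu(Y)=\int\nu(Y-p)\,d\Pi_P(p),$$ and $\Pi_Q$, $\Pi_P$ are the spectral measures of the position operator $Q$ (multiplication by $x$) and of the momentum operator $P=-i\,d/dx$ on $L^2(\mathbb R)$. -/

import Mathlib

open MeasureTheory
open scoped ENNReal

noncomputable section

namespace PosMom

/-! ### Observables on a complex Hilbert space -/

section Observables

variable {H : Type*} [NormedAddCommGroup H] [InnerProductSpace ℂ H] [CompleteSpace H]

/-- An observable: a normalized positive operator measure `E` on the measurable sets of `Ω`,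
σ-additive for the weak operator topology. (Values on non-measurable sets are irrelevant and
never used.) -/
structure IsObservable {Ω : Type*} [MeasurableSpace Ω] (E : Set Ω → H →L[ℂ] H) : Prop where
  positive : ∀ X, MeasurableSet X → (E X).IsPositive
  normalized : E Set.univ = 1
  sigma_additive : ∀ X : ℕ → Set Ω, (∀ n, MeasurableSet (X n)) →
    Pairwise (fun m n => Disjoint (X m) (X n)) →
    ∀ φ ψ : H, HasSum (fun n => inner ℂ φ (E (X n) ψ)) (inner ℂ φ (E (⋃ n, X n) ψ))

/-- The commutation domain of `E₁` and `E₂`: the subspace of all vectors `ψ` such that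
`E₁(X) E₂(Y) ψ - E₂(Y) E₁(X) ψ = 0` for all Borel sets `X`, `Y`. -/
def com (E₁ E₂ : Set ℝ → H →L[ℂ] H) : Submodule ℂ H where
  carrier := {ψ | ∀ X Y : Set ℝ, MeasurableSet X → MeasurableSet Y →
    E₁ X (E₂ Y ψ) - E₂ Y (E₁ X ψ) = 0}
  zero_mem' := by
    intro X Y _ _
    simp
  add_mem' := by
    intro a b ha hb X Y hX hY
    have h1 := ha X Y hX hY
    have h2 := hb X Y hX hY
    simp only [map_add]
    rw [add_sub_add_comm, h1, h2, add_zero]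
  smul_mem' := by
    intro c a ha X Y hX hY
    have h1 := ha X Y hX hY
    simp only [map_smul]
    rw [← smul_sub, h1, smul_zero]

end Observables

/-! ### The Hilbert space `L²(ℝ)` with its translations and boosts -/

/-- The Hilbert space `L²(ℝ)` of complex square integrable functions. -/
abbrev L2R : Type := Lp ℂ 2 (volume : Measure ℝ)

open Classical in
/-- The bounded operator `ψ ↦ f ψ` of multiplication by an essentially bounded measurable
function `f` on `ℝ`, i.e. the operator `f(Q) = ∫ f dΠ_Q`; in particular `Π_Q(X)` is
multiplication by the characteristic function of `X`. (The value is `0` if `f` is not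
essentially bounded and measurable.) -/
def mulOp (f : ℝ → ℂ) : L2R →L[ℂ] L2R :=
  if h : MemLp f ∞ (volume : Measure ℝ) then
    (ContinuousLinearMap.mul ℂ ℂ).holderL volume ∞ 2 2 (h.toLp f)
  else 0

theorem mulOp_apply_ae {f : ℝ → ℂ} (h : MemLp f ∞ (volume : Measure ℝ)) (ψ : L2R) :
    mulOp f ψ =ᵐ[volume] fun x => f x * ψ x := by
  rw [mulOp, dif_pos h, ContinuousLinearMap.holderL_apply_apply]
  refine ((ContinuousLinearMap.mul ℂ ℂ).coeFn_holder _ _).trans ?_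
  filter_upwards [h.coeFn_toLp] with x hx
  simp [hx]

/-- Space translations: `[U(q) ψ](x) = ψ(x - q)`. -/
def U (q : ℝ) : L2R →L[ℂ] L2R :=
  (Lp.compMeasurePreservingₗᵢ ℂ (fun x : ℝ => x - q)
    (measurePreserving_sub_right volume q)).toContinuousLinearMap

theorem U_apply_ae (q : ℝ) (ψ : L2R) : U q ψ =ᵐ[volume] fun x => ψ (x - q) :=
  Lp.coeFn_compMeasurePreserving ψ (measurePreserving_sub_right volume q)

/-- Velocity boosts: `[V(p) ψ](x) = e^{ipx} ψ(x)`. -/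
def V (p : ℝ) : L2R →L[ℂ] L2R :=
  mulOp (fun x : ℝ => Complex.exp (Complex.I * p * x))

theorem V_apply_ae (p : ℝ) (ψ : L2R) :
    V p ψ =ᵐ[volume] fun x : ℝ => Complex.exp (Complex.I * p * x) * ψ x := by
  refine mulOp_apply_ae (memLp_top_of_bound (by fun_prop) 1 (.of_forall fun x => ?_)) ψ
  simp [Complex.norm_exp]

/-! ### Position and momentum observables -/

/-- A position observable: an observable on the Borel sets of `ℝ` that is translation covariant,
`U(q) E(X) U(q)* = E(X + q)`, and boost invariant, `V(p) E(X) V(p)* = E(X)`. -/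
structure IsPositionObservable (E : Set ℝ → L2R →L[ℂ] L2R) : Prop where
  observable : IsObservable E
  covariant : ∀ (q : ℝ) (X : Set ℝ), MeasurableSet X →
    U q ∘L E X ∘L (U q).adjoint = E ((fun x => x + q) '' X)
  invariant : ∀ (p : ℝ) (X : Set ℝ), MeasurableSet X →
    V p ∘L E X ∘L (V p).adjoint = E X

/-- A momentum observable: an observable on the Borel sets of `ℝ` that is boost covariant,
`V(p) F(Y) V(p)* = F(Y + p)`, and translation invariant, `U(q) F(Y) U(q)* = F(Y)`. -/
structure IsMomentumObservable (F : Set ℝ → L2R →L[ℂ] L2R) : Prop where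
  observable : IsObservable F
  covariant : ∀ (p : ℝ) (Y : Set ℝ), MeasurableSet Y →
    V p ∘L F Y ∘L (V p).adjoint = F ((fun y => y + p) '' Y)
  invariant : ∀ (q : ℝ) (Y : Set ℝ), MeasurableSet Y →
    U q ∘L F Y ∘L (U q).adjoint = F Y

/-- The operator `g(P) = ∫ g dΠ_P`, where `P = -i d/dx` is the momentum operator and `Π_P` its
spectral measure. Mathlib's Fourier-Plancherel operator uses the kernel `e^{-2πixξ}`, so that `P`
is multiplication by `p = 2πξ` on the Fourier side. -/
def momentumOp (g : ℝ → ℂ) : L2R →L[ℂ] L2R :=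
  (Lp.fourierTransformₗᵢ ℝ ℂ).symm.toContinuousLinearEquiv.toContinuousLinearMap ∘L
    mulOp (fun ξ => g (2 * Real.pi * ξ)) ∘L
    (Lp.fourierTransformₗᵢ ℝ ℂ).toContinuousLinearEquiv.toContinuousLinearMap

/-- The function `q ↦ ρ(X - q)`, where `X - q = {x - q | x ∈ X}`. -/
def smear (ρ : Measure ℝ) (X : Set ℝ) (q : ℝ) : ℂ :=
  (ρ.real ((fun x => x - q) '' X) : ℂ)

/-- For Borel `X`, the function `q ↦ ρ(X - q)` is bounded and measurable. -/
theorem memLp_smear (ρ : Measure ℝ) [IsProbabilityMeasure ρ] {X : Set ℝ} (hX : MeasurableSet X)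
    {c : ℝ} : MemLp (fun q => smear ρ X (c * q)) ∞ (volume : Measure ℝ) := by
  have key : Measurable (smear ρ X) := by
    have h : Measurable fun q : ℝ => ρ (Prod.mk q ⁻¹' {z : ℝ × ℝ | z.2 + z.1 ∈ X}) :=
      measurable_measure_prodMk_left ((measurable_snd.add measurable_fst) hX)
    have e : smear ρ X =
        fun q => ((ρ (Prod.mk q ⁻¹' {z : ℝ × ℝ | z.2 + z.1 ∈ X})).toReal : ℂ) := by
      funext q
      have hs : (fun x => x - q) '' X = Prod.mk q ⁻¹' {z : ℝ × ℝ | z.2 + z.1 ∈ X} := by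
        ext y
        constructor
        · rintro ⟨x, hx, rfl⟩
          simpa using hx
        · intro hy
          exact ⟨y + q, hy, by simp⟩
      simp only [smear, Measure.real, hs]
    rw [e]
    exact Complex.measurable_ofReal.comp h.ennreal_toReal
  refine memLp_top_of_bound (key.comp (measurable_const_mul c)).aestronglyMeasurable 1
    (.of_forall fun q => ?_)
  simp only [smear, Complex.norm_real, Real.norm_eq_abs, abs_of_nonneg measureReal_nonneg]
  exact measureReal_le_one

/-- The position observable `E_ρ(X) = ∫ ρ(X - q) dΠ_Q(q)`. -/
def positionObs (ρ : Measure ℝ) (X : Set ℝ) : L2R →L[ℂ] L2R :=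
  mulOp (smear ρ X)

/-- The momentum observable `F_ν(Y) = ∫ ν(Y - p) dΠ_P(p)`. -/
def momentumObs (ν : Measure ℝ) (Y : Set ℝ) : L2R →L[ℂ] L2R :=
  momentumOp (smear ν Y)

end PosMom

end

noncomputable section

namespace PosMom

/-! ### Integrable functions and their Fourier transforms -/

/-! The effect $E([0,1))$ is positive and commutes with all boosts, so it is multiplication by some
$k\ge 0$. By covariance $E([a,a+1))$ is multiplication by $k(x-a)$, and normalization of $E$ forces
$\int k=1$ (`IsPositionObservable.exists_isCellDensity`).

Let $\psi\in\mathrm{com}(E,F)$ and fix $\varphi$ and $Y$. Then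
$w=\bar\varphi\,F(Y)\psi-\overline{F(Y)^*\varphi}\,\psi$ is integrable, and $\int
k(x-a)w(x)\,dx=\langle\varphi,[E([a,a+1)),F(Y)]\psi\rangle=0$ for all $a$. In Fourier space this is
a product equal to zero. The factor coming from $k$ is continuous and nonzero at frequency $0$, so
$\int e^{itx}w=0$ for some $t>0$ depending on $k$ alone (`exists_pos_integral_exp_mul_eq_zero`).
Hence $V(t)F(Y)\psi=F(Y)V(t)\psi$ for every $Y$.

Covariance of $F$ turns this into $F(Y+t)V(t)\psi=F(Y)V(t)\psi$. The cells $[nt,(n+1)t)$ then all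
carry the same weight in the state $V(t)\psi$. These infinitely many equal weights sum to
$\|V(t)\psi\|^2<\infty$, so they vanish and $\psi=0$ (`IsMomentumObservable.eq_zero_of_V_comm`).

For $E_\rho$ and $F_\nu$ it remains to check the covariance axioms; for $F_\nu$ this uses that the
Fourier transform exchanges translations and boosts. -/

/-- An integrable function on `ℝ` whose Fourier transform vanishes is zero almost everywhere. -/
theorem ae_eq_zero_of_integral_exp_mul_eq_zero {w : ℝ → ℂ} (hw : Integrable w)
    (h : ∀ p : ℝ, ∫ x : ℝ, Complex.exp (Complex.I * p * x) * w x = 0) : w =ᵐ[volume] 0 := by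
  have hF : ∀ ξ : ℝ, FourierTransform.fourier w ξ = 0 := by
    intro ξ
    rw [Real.fourier_real_eq_integral_exp_smul]
    rw [← h (-2 * Real.pi * ξ)]
    refine integral_congr_ae (.of_forall fun x => ?_)
    simp only [smul_eq_mul]
    congr 2
    push_cast
    ring
  -- A test function $g$ is the Fourier transform of a Schwartz function $\check g$, so $\int
  -- g\,w=\int\check g\,\hat w=0$.
  refine ae_eq_zero_of_integral_contDiff_smul_eq_zero hw.locallyIntegrable fun g hg hgs => ?_
  have hgc : ContDiff ℝ (⊤ : ℕ∞) fun x => (g x : ℂ) := Complex.ofRealCLM.contDiff.comp hg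
  have hgsc : HasCompactSupport fun x => (g x : ℂ) := hgs.comp_left Complex.ofReal_zero
  let s : SchwartzMap ℝ ℂ := hgsc.toSchwartzMap hgc
  have key := VectorFourier.integral_fourierIntegral_smul_eq_flip (μ := volume) (ν := volume)
    (L := innerₗ ℝ) Real.continuous_fourierChar continuous_inner
    (FourierTransform.fourierInv s).integrable hw
  have h1 : ∀ ξ : ℝ, VectorFourier.fourierIntegral Real.fourierChar volume (innerₗ ℝ)
      (FourierTransform.fourierInv s : SchwartzMap ℝ ℂ) ξ = (g ξ : ℂ) := by
    intro ξ
    have h2 : FourierTransform.fourier (FourierTransform.fourierInv s) = s :=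
      FourierTransform.fourier_fourierInv_eq s
    exact DFunLike.congr_fun h2 ξ
  have h3 : ∀ ξ : ℝ, VectorFourier.fourierIntegral Real.fourierChar volume (innerₗ ℝ).flip w ξ
      = 0 := by
    intro ξ
    rw [flip_innerₗ]
    exact hF ξ
  simp only [h1, h3, smul_zero, integral_zero] at key
  simpa using key

/-- If all translates of an integrable function `h` with nonzero integral annihilate an
integrable function `w`, then the Fourier transform of `w` vanishes near `0`. -/
theorem exists_pos_integral_exp_mul_eq_zero {h : ℝ → ℂ} (hh : Integrable h)
    (h0 : ∫ x, h x ≠ 0) :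
    ∃ t : ℝ, 0 < t ∧ ∀ w : ℝ → ℂ, Integrable w → (∀ a : ℝ, ∫ x, h (x - a) * w x = 0) →
      ∫ x : ℝ, Complex.exp (Complex.I * t * x) * w x = 0 := by
  have hexp : ∀ t x : ℝ, ‖Complex.exp (Complex.I * t * x)‖ = 1 := fun t x => by
    simp [Complex.norm_exp]
  have hint : ∀ (t : ℝ) {f : ℝ → ℂ}, Integrable f →
      Integrable fun x : ℝ => Complex.exp (Complex.I * t * x) * f x := fun t f hf =>
    hf.bdd_mul (c := 1) (by fun_prop) (.of_forall fun x => (hexp t x).le)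
  have hneg : Integrable fun x => h (-x) := hh.comp_neg
  have hcont : Continuous fun t : ℝ => ∫ x : ℝ, Complex.exp (Complex.I * t * x) * h (-x) := by
    refine continuous_of_dominated (bound := fun x => ‖h (-x)‖)
      (fun t => (hint t hneg).aestronglyMeasurable) (fun t => .of_forall fun x => ?_) hneg.norm
      (.of_forall fun x => by fun_prop)
    rw [norm_mul, hexp, one_mul]
  have hne : (∫ x : ℝ, Complex.exp (Complex.I * (0 : ℝ) * x) * h (-x)) ≠ 0 := by
    simpa [integral_neg_eq_self (fun x => h x)] using h0
  have hev := (hcont.tendsto 0).eventually_ne hne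
  -- `t` is fixed before `w` appears, so one boost will serve for all $\varphi$ and $Y$.
  obtain ⟨t, ht, htpos⟩ := ((hev.filter_mono nhdsWithin_le_nhds).and
    (self_mem_nhdsWithin (s := Set.Ioi (0 : ℝ)))).exists
  refine ⟨t, htpos, fun w hw hzero => ?_⟩
  -- Twisting both factors by the same character makes the convolution at $a$ equal to $e^{ita}\int
  -- h(x-a)w(x)\,dx=0$, while its total integral is the product of the two Fourier integrals.
  have hconv := integral_convolution (ContinuousLinearMap.mul ℂ ℂ) (hint t hw) (hint t hneg)
  have hz : ∀ a : ℝ, convolution (fun x : ℝ => Complex.exp (Complex.I * t * x) * w x)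
      (fun x : ℝ => Complex.exp (Complex.I * t * x) * h (-x)) (ContinuousLinearMap.mul ℂ ℂ)
      volume a = 0 := by
    intro a
    rw [convolution_def]
    have : ∀ x : ℝ, (ContinuousLinearMap.mul ℂ ℂ) (Complex.exp (Complex.I * t * x) * w x)
        (Complex.exp (Complex.I * t * (a - x : ℝ)) * h (-(a - x))) =
        Complex.exp (Complex.I * t * a) * (h (x - a) * w x) := by
      intro x
      have e : Complex.exp (Complex.I * t * a) =
          Complex.exp (Complex.I * t * x) * Complex.exp (Complex.I * t * (a - x : ℝ)) := by
        rw [← Complex.exp_add]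
        congr 1
        push_cast
        ring
      rw [e, neg_sub, ContinuousLinearMap.mul_apply']
      ring
    simp_rw [this]
    rw [integral_const_mul, hzero a, mul_zero]
  simp only [hz, integral_zero, ContinuousLinearMap.mul_apply'] at hconv
  exact (mul_eq_zero.mp hconv.symm).resolve_right ht

/-! ### Translations, boosts and multiplication operators -/

theorem inner_L2R (φ ψ : L2R) : inner ℂ φ ψ = ∫ x, star (φ x) * ψ x := by
  rw [L2.inner_def]
  refine integral_congr_ae (.of_forall fun x => ?_)
  simp [mul_comm]

theorem integrable_star_mul (φ ψ : L2R) : Integrable fun x => star (φ x) * ψ x := by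
  refine (L2.integrable_inner (𝕜 := ℂ) φ ψ).congr (.of_forall fun x => ?_)
  simp [mul_comm]

theorem comp_sub_ae {f g : ℝ → ℂ} (h : f =ᵐ[volume] g) (q : ℝ) :
    (fun x => f (x - q)) =ᵐ[volume] fun x => g (x - q) :=
  (measurePreserving_sub_right volume q).quasiMeasurePreserving.ae_eq_comp h

theorem U_U_neg (q : ℝ) (ψ : L2R) : U q (U (-q) ψ) = ψ := by
  refine Lp.ext ?_
  filter_upwards [U_apply_ae q (U (-q) ψ), comp_sub_ae (U_apply_ae (-q) ψ) q] with x h1 h2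
  rw [h1, h2]
  congr 1
  ring

theorem inner_U_U (q : ℝ) (φ ψ : L2R) : inner ℂ (U q φ) (U q ψ) = inner ℂ φ ψ :=
  (Lp.compMeasurePreservingₗᵢ ℂ (fun x : ℝ => x - q)
    (measurePreserving_sub_right volume q)).inner_map_map φ ψ

theorem U_adjoint (q : ℝ) : (U q).adjoint = U (-q) := by
  symm
  rw [ContinuousLinearMap.eq_adjoint_iff]
  intro φ ψ
  rw [← inner_U_U q, U_U_neg]

theorem star_exp_I_mul (p x : ℝ) :
    star (Complex.exp (Complex.I * p * x)) = Complex.exp (Complex.I * (-p : ℝ) * x) := by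
  rw [RCLike.star_def, ← Complex.exp_conj]
  simp

theorem exp_mul_exp_neg (p x : ℝ) :
    Complex.exp (Complex.I * p * x) * Complex.exp (Complex.I * (-p : ℝ) * x) = 1 := by
  rw [← Complex.exp_add]
  simp

theorem V_V_neg (p : ℝ) (ψ : L2R) : V p (V (-p) ψ) = ψ := by
  refine Lp.ext ?_
  filter_upwards [V_apply_ae p (V (-p) ψ), V_apply_ae (-p) ψ] with x h1 h2
  rw [h1, h2, ← mul_assoc, exp_mul_exp_neg, one_mul]

theorem V_adjoint (p : ℝ) : (V p).adjoint = V (-p) := by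
  symm
  rw [ContinuousLinearMap.eq_adjoint_iff]
  intro φ ψ
  rw [inner_L2R, inner_L2R]
  refine integral_congr_ae ?_
  filter_upwards [V_apply_ae (-p) φ, V_apply_ae p ψ] with x h1 h2
  rw [h1, h2, star_mul', star_exp_I_mul, neg_neg]
  ring

theorem inner_V (p : ℝ) (φ ψ : L2R) : inner ℂ φ (V p ψ) =
    ∫ x : ℝ, Complex.exp (Complex.I * p * x) * (star (φ x) * ψ x) := by
  rw [inner_L2R]
  refine integral_congr_ae ?_
  filter_upwards [V_apply_ae p ψ] with x hx
  rw [hx]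
  ring

theorem integrable_exp_mul_star_mul (p : ℝ) (φ ψ : L2R) :
    Integrable fun x : ℝ => Complex.exp (Complex.I * p * x) * (star (φ x) * ψ x) :=
  (integrable_star_mul φ ψ).bdd_mul (c := 1) (by fun_prop)
    (.of_forall fun x => by simp [Complex.norm_exp])

/-- Conjugating `A` by `U q` yields `B` if and only if `U q` intertwines `A` and `B`. -/
theorem U_conj_eq_iff {q : ℝ} {A B : L2R →L[ℂ] L2R} :
    U q ∘L A ∘L (U q).adjoint = B ↔ ∀ ψ, U q (A ψ) = B (U q ψ) := by
  rw [U_adjoint]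
  constructor
  · rintro rfl ψ
    have h := U_U_neg (-q) ψ
    rw [neg_neg] at h
    simp [h]
  · intro h
    ext1 ψ
    simp [h, U_U_neg]

/-- Conjugating `A` by `V p` yields `B` if and only if `V p` intertwines `A` and `B`. -/
theorem V_conj_eq_iff {p : ℝ} {A B : L2R →L[ℂ] L2R} :
    V p ∘L A ∘L (V p).adjoint = B ↔ ∀ ψ, V p (A ψ) = B (V p ψ) := by
  rw [V_adjoint]
  constructor
  · rintro rfl ψ
    have h := V_V_neg (-p) ψ
    rw [neg_neg] at h
    simp [h]
  · intro h
    ext1 ψ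
    simp [h, V_V_neg]

/-! ### Cells of length `t` -/

theorem image_add_Ico_cell (t : ℝ) (n : ℤ) :
    (fun x : ℝ => x + n * t) '' Set.Ico 0 t = Set.Ico (n * t) ((n + 1) * t) := by
  rw [Set.image_add_const_Ico]
  congr 1 <;> ring

theorem iUnion_Ico_cell {t : ℝ} (ht : 0 < t) :
    ⋃ n : ℤ, Set.Ico (n * t : ℝ) ((n + 1) * t) = Set.univ := by
  have := iUnion_Ico_add_zsmul ht 0
  simpa using this

theorem pairwise_disjoint_Ico_cell (t : ℝ) :
    Pairwise fun m n : ℤ => Disjoint (Set.Ico (m * t : ℝ) ((m + 1) * t))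
      (Set.Ico (n * t : ℝ) ((n + 1) * t)) := by
  have := Set.pairwise_disjoint_Ico_add_zsmul (0 : ℝ) t
  simpa only [zero_add, zsmul_eq_mul, Int.cast_add, Int.cast_one] using! this

/-- The cells `[nt, (n+1)t)` resolve the identity under an observable. -/
theorem IsObservable.hasSum_cell {H : Type*} [NormedAddCommGroup H] [InnerProductSpace ℂ H]
    [CompleteSpace H] {E : Set ℝ → H →L[ℂ] H} (hE : IsObservable E) {t : ℝ} (ht : 0 < t)
    (φ ψ : H) :
    HasSum (fun n : ℤ => inner ℂ φ (E (Set.Ico (n * t : ℝ) ((n + 1) * t)) ψ))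
      (inner ℂ φ ψ) := by
  -- σ-additivity is stated for sequences over `ℕ`, whereas the cells are indexed by `ℤ`.
  let e : ℕ ≃ ℤ := (Denumerable.eqv ℤ).symm
  have h := hE.sigma_additive (fun k => Set.Ico ((e k : ℤ) * t : ℝ) (((e k : ℤ) + 1) * t))
    (fun _ => measurableSet_Ico)
    (fun m n hmn => pairwise_disjoint_Ico_cell t (e.injective.ne hmn)) φ ψ
  rw [e.surjective.iUnion_comp (fun n : ℤ => Set.Ico (n * t : ℝ) ((n + 1) * t)),
    iUnion_Ico_cell ht, hE.normalized] at h
  exact e.hasSum_iff.mp h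


/-! ### The commutant of the boosts -/

theorem memLp_gaussian : MemLp (fun x : ℝ => (Real.exp (-x ^ 2) : ℂ)) 2 volume := by
  rw [memLp_two_iff_integrable_sq_norm (by fun_prop)]
  refine (integrable_exp_neg_mul_sq (b := 2) two_pos).congr (.of_forall fun x => ?_)
  simp only [Complex.norm_real, Real.norm_eq_abs, Real.abs_exp, sq (Real.exp _), ← Real.exp_add]
  congr 1
  ring

/-- A bounded operator commuting with all boosts is a multiplication operator. -/
theorem exists_mul_of_commute_V {T : L2R →L[ℂ] L2R} (hT : ∀ p ψ, V p (T ψ) = T (V p ψ)) :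
    ∃ h : ℝ → ℂ, Measurable h ∧ ∀ ψ : L2R, T ψ =ᵐ[volume] fun x => h x * ψ x := by
  -- The two densities have the same Fourier transform, because $\langle
  -- T^*\varphi,V(p)\psi\rangle=\langle\varphi,V(p)T\psi\rangle$.
  have key : ∀ φ ψ : L2R, (fun x => star (T.adjoint φ x) * ψ x) =ᵐ[volume]
      fun x => star (φ x) * T ψ x := by
    intro φ ψ
    have h0 : (fun x => star (T.adjoint φ x) * ψ x - star (φ x) * T ψ x) =ᵐ[volume] 0 := by
      refine ae_eq_zero_of_integral_exp_mul_eq_zero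
        ((integrable_star_mul _ _).sub (integrable_star_mul _ _)) fun p => ?_
      simp_rw [mul_sub]
      rw [integral_sub (integrable_exp_mul_star_mul _ _ _) (integrable_exp_mul_star_mul _ _ _),
        ← inner_V, ← inner_V, ContinuousLinearMap.adjoint_inner_left, hT, sub_self]
    filter_upwards [h0] with x hx
    exact sub_eq_zero.mp hx
  -- The Gaussian is a real, nowhere vanishing vector of $L^2$; `key` with $\varphi=g$ can be
  -- divided by it, giving the multiplier $\overline{T^*g}/g$.
  let g : L2R := memLp_gaussian.toLp _
  have hg : g =ᵐ[volume] fun x : ℝ => (Real.exp (-x ^ 2) : ℂ) := memLp_gaussian.coeFn_toLp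
  obtain ⟨s, hs, hTs⟩ := (Lp.aestronglyMeasurable (T.adjoint g)).aemeasurable
  refine ⟨fun x => star (s x) / (Real.exp (-x ^ 2) : ℂ), by fun_prop, fun ψ => ?_⟩
  filter_upwards [hg, hTs, key g ψ] with x h1 h2 h3
  have hne : (Real.exp (-x ^ 2) : ℂ) ≠ 0 := by exact_mod_cast (Real.exp_pos _).ne'
  rw [h2, h1, RCLike.star_def, Complex.conj_ofReal] at h3
  rw [RCLike.star_def, div_mul_eq_mul_div, h3]
  field_simp

open scoped ComplexOrder in
/-- A positive operator commuting with all boosts is multiplication by a nonnegative function. -/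
theorem exists_nonneg_mul_of_commute_V {T : L2R →L[ℂ] L2R} (hpos : T.IsPositive)
    (hT : ∀ p ψ, V p (T ψ) = T (V p ψ)) :
    ∃ k : ℝ → ℝ, (∀ s, MeasurableSet s → volume s < ∞ → IntegrableOn k s) ∧ 0 ≤ᵐ[volume] k ∧
      ∀ ψ : L2R, T ψ =ᵐ[volume] fun x => (k x : ℂ) * ψ x := by
  obtain ⟨h, -, hTh⟩ := exists_mul_of_commute_V hT
  -- On $s$ the multiplier agrees with $T1_s\in L^2$; hence it is locally integrable, and $\int_s
  -- h=\langle 1_s,T1_s\rangle\ge 0$.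
  have hind : ∀ (s : Set ℝ) (hs : MeasurableSet s) (hμ : volume s ≠ ∞),
      (T (indicatorConstLp 2 hs hμ (1 : ℂ))) =ᵐ[volume.restrict s] h := by
    intro s hs hμ
    rw [Filter.EventuallyEq, ae_restrict_iff' hs]
    filter_upwards [hTh (indicatorConstLp 2 hs hμ (1 : ℂ)),
      indicatorConstLp_coeFn (p := 2) (hs := hs) (hμs := hμ) (c := (1 : ℂ))] with x h1 h2 hx
    rw [h1, h2, Set.indicator_of_mem hx, mul_one]
  have hint : ∀ s, MeasurableSet s → volume s < ∞ → IntegrableOn h s := by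
    intro s hs hμ
    exact (integrableOn_Lp_of_measure_ne_top _ fact_one_le_two_ennreal.elim hμ.ne).congr
      (hind s hs hμ.ne)
  have hnn : ∀ s, MeasurableSet s → volume s < ∞ → 0 ≤ ∫ x in s, h x := by
    intro s hs hμ
    have h1 := hpos.inner_nonneg_right (indicatorConstLp 2 hs hμ.ne (1 : ℂ))
    rw [L2.inner_indicatorConstLp_one] at h1
    rwa [integral_congr_ae (hind s hs hμ.ne)] at h1
  have hre : 0 ≤ᵐ[volume] fun x => (h x).re := by
    refine ae_nonneg_of_forall_setIntegral_nonneg_of_sigmaFinite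
      (fun s hs hμ => (hint s hs hμ).re) fun s hs hμ => ?_
    have := (Complex.nonneg_iff.mp (hnn s hs hμ)).1
    rwa [← RCLike.re_eq_complex_re, ← integral_re (hint s hs hμ)] at this
  have him0 : ∀ s, MeasurableSet s → volume s < ∞ → ∫ x in s, (h x).im = 0 := by
    intro s hs hμ
    have := (Complex.nonneg_iff.mp (hnn s hs hμ)).2
    rw [← RCLike.im_eq_complex_im, ← integral_im (hint s hs hμ)] at this
    exact this.symm
  have him : (fun x => (h x).im) =ᵐ[volume] 0 :=
    ae_eq_zero_of_forall_setIntegral_eq_of_sigmaFinite (fun s hs hμ => (hint s hs hμ).im) him0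
  refine ⟨fun x => (h x).re, fun s hs hμ => (hint s hs hμ).re, hre, fun ψ => ?_⟩
  filter_upwards [hTh ψ, him] with x h1 h2
  rw [h1]
  congr 1
  exact Complex.ext rfl (by simpa using h2)

/-! ### The density of a position observable -/

/-- The effects under `E` of the translates of the cell `[0, 1)` are the multiplications by the
translates of the integrable function `h`, whose integral does not vanish. -/
structure IsCellDensity (E : Set ℝ → L2R →L[ℂ] L2R) (h : ℝ → ℂ) : Prop where
  integrable : Integrable h
  integral_ne_zero : ∫ x, h x ≠ 0
  apply_ae : ∀ a : ℝ, ∀ ψ : L2R,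
    E ((fun x => x + a) '' Set.Ico 0 1) ψ =ᵐ[volume] fun x => h (x - a) * ψ x

theorem IsPositionObservable.exists_isCellDensity {E : Set ℝ → L2R →L[ℂ] L2R}
    (hE : IsPositionObservable E) : ∃ h, IsCellDensity E h := by
  obtain ⟨k, hkint, hk0, hk⟩ := exists_nonneg_mul_of_commute_V
    (hE.observable.positive (Set.Ico 0 1) measurableSet_Ico)
    (fun p => V_conj_eq_iff.mp (hE.invariant p (Set.Ico 0 1) measurableSet_Ico))
  have happ : ∀ a : ℝ, ∀ ψ : L2R, E ((fun x => x + a) '' Set.Ico 0 1) ψ =ᵐ[volume]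
      fun x => (k (x - a) : ℂ) * ψ x := by
    intro a ψ
    have hc := U_conj_eq_iff.mp (hE.covariant a (Set.Ico 0 1) measurableSet_Ico) (U (-a) ψ)
    rw [U_U_neg] at hc
    rw [← hc]
    have h3 : U a (U (-a) ψ) =ᵐ[volume] fun x => ψ x := by rw [U_U_neg]
    filter_upwards [U_apply_ae a (E (Set.Ico 0 1) (U (-a) ψ)), comp_sub_ae (hk (U (-a) ψ)) a,
      U_apply_ae a (U (-a) ψ), h3] with x h1 h2 h3 h4
    rw [h1, h2, ← h3, h4]
  have hμ : volume (Set.Ico (0 : ℝ) 1) ≠ ∞ := by simp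
  -- In the state $u=1_{[0,1)}$ the cell $[n,n+1)$ has weight $\int_{-n}^{-n+1}k$. Summing over $n$
  -- gives $\int k=\|u\|^2=1$.
  let u : L2R := indicatorConstLp 2 measurableSet_Ico hμ (1 : ℂ)
  have hsum := hE.observable.hasSum_cell one_pos u u
  have hterm : ∀ n : ℤ, inner ℂ u (E (Set.Ico (n * 1 : ℝ) ((n + 1) * 1)) u) =
      ((∫ x in Set.Ico ((-n : ℤ) : ℝ) ((-n : ℤ) + 1), k x : ℝ) : ℂ) := by
    intro n
    rw [L2.inner_indicatorConstLp_one, ← image_add_Ico_cell, mul_one]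
    have h1 : ∫ x in Set.Ico (0 : ℝ) 1, (E ((fun x : ℝ => x + n) '' Set.Ico 0 1) u) x =
        ∫ x in Set.Ico (0 : ℝ) 1, (k (x - n) : ℂ) := by
      refine setIntegral_congr_ae measurableSet_Ico ?_
      filter_upwards [happ n u, indicatorConstLp_coeFn (p := 2) (hs := measurableSet_Ico)
        (hμs := hμ) (c := (1 : ℂ))] with x h1 h2 hx
      rw [h1, h2, Set.indicator_of_mem hx, mul_one]
    rw [h1, integral_complex_ofReal]
    congr 1
    have := (measurePreserving_sub_right volume (n : ℝ)).setIntegral_preimage_emb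
      (measurableEmbedding_subRight (n : ℝ)) k (Set.Ico ((-n : ℤ) : ℝ) ((-n : ℤ) + 1))
    rw [← this]
    congr 2
    ext x
    simp [Set.mem_Ico]
  have huu : inner ℂ u u = ((1 : ℝ) : ℂ) := by
    rw [L2.inner_indicatorConstLp_one, setIntegral_congr_ae (g := fun _ => (1 : ℂ))
      measurableSet_Ico]
    · simp
    · filter_upwards [indicatorConstLp_coeFn (p := 2) (hs := measurableSet_Ico)
        (hμs := hμ) (c := (1 : ℂ))] with x h2 hx
      rw [h2, Set.indicator_of_mem hx]
  simp_rw [hterm] at hsum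
  rw [huu] at hsum
  have hsum' : HasSum (fun n : ℤ => ∫ x in Set.Ico (n : ℝ) (n + 1), k x) 1 :=
    (Equiv.neg ℤ).hasSum_iff.mp (Complex.hasSum_ofReal.mp hsum)
  -- Since $k\ge 0$, the summable cell integrals are also the integrals of $|k|$.
  have hkI : Integrable k := by
    have h1 := integrableOn_iUnion_of_summable_integral_norm (μ := volume) (f := k)
      (s := fun n : ℤ => Set.Ico (n : ℝ) (n + 1))
      (fun n => hkint _ measurableSet_Ico (by simp)) (by
        convert hsum'.summable using 2 with n
        refine integral_congr_ae ?_
        filter_upwards [ae_restrict_of_ae hk0] with x hx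
        exact Real.norm_of_nonneg hx)
    rwa [iUnion_Ico_intCast, integrableOn_univ] at h1
  have hone : ∫ x, k x = 1 := by
    have h1 := hasSum_integral_iUnion (μ := volume) (f := k)
      (s := fun n : ℤ => Set.Ico (n : ℝ) (n + 1)) (fun _ => measurableSet_Ico)
      (Set.pairwise_disjoint_Ico_intCast ℝ) hkI.integrableOn
    rw [iUnion_Ico_intCast, setIntegral_univ] at h1
    exact h1.unique hsum'
  exact ⟨fun x => k x, hkI.ofReal, by rw [integral_complex_ofReal, hone]; simp, happ⟩


/-! ### Total noncommutativity -/

/-- A momentum observable does not commute with any nontrivial boost on a nonzero vector. -/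
theorem IsMomentumObservable.eq_zero_of_V_comm {F : Set ℝ → L2R →L[ℂ] L2R}
    (hF : IsMomentumObservable F) {t : ℝ} (ht : 0 < t) {ψ : L2R}
    (h : ∀ Y, MeasurableSet Y → V t (F Y ψ) = F Y (V t ψ)) : ψ = 0 := by
  have hshift : ∀ Y, MeasurableSet Y →
      F ((fun y => y + t) '' Y) (V t ψ) = F Y (V t ψ) := fun Y hY =>
    (V_conj_eq_iff.mp (hF.covariant t Y hY) ψ).symm.trans (h Y hY)
  let c : ℤ → ℂ := fun n =>
    inner ℂ (V t ψ) (F (Set.Ico (n * t : ℝ) ((n + 1) * t)) (V t ψ))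
  have hsucc : ∀ n, c (n + 1) = c n := by
    intro n
    have hset : (fun y => y + t) '' Set.Ico (n * t : ℝ) ((n + 1) * t) =
        Set.Ico (((n + 1 : ℤ) : ℝ) * t) (((n + 1 : ℤ) + 1) * t) := by
      rw [Set.image_add_const_Ico]
      congr 1 <;> push_cast <;> ring
    have := hshift _ (measurableSet_Ico (a := (n * t : ℝ)) (b := (n + 1) * t))
    rw [hset] at this
    simp only [c, this]
  have hconst : ∀ n, c n = c 0 := by
    intro n
    induction n using Int.induction_on with
    | zero => rfl
    | succ n ih => rw [hsucc, ih]
    | pred n ih => rw [← ih, ← hsucc, sub_add_cancel]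
  have hsum : HasSum c (inner ℂ (V t ψ) (V t ψ)) :=
    hF.observable.hasSum_cell ht (V t ψ) (V t ψ)
  have hc : c = fun _ => c 0 := funext hconst
  -- A constant family over the infinite set `ℤ` is summable only if it is zero.
  have hc0 : c 0 = 0 := by
    have hs := hsum.summable
    rw [hc] at hs
    exact (summable_const_iff _).mp hs
  rw [hc, hc0] at hsum
  have hV : V t ψ = 0 := inner_self_eq_zero.mp (hsum.unique hasSum_zero)
  have hVV := V_V_neg (-t) ψ
  rw [neg_neg, hV, map_zero] at hVV
  exact hVV.symm

/-- Position and momentum observables are totally noncommutative. -/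
theorem com_eq_bot {E F : Set ℝ → L2R →L[ℂ] L2R} (hE : IsPositionObservable E)
    (hF : IsMomentumObservable F) : com E F = ⊥ := by
  obtain ⟨h, hh⟩ := hE.exists_isCellDensity
  obtain ⟨t, ht, key⟩ := exists_pos_integral_exp_mul_eq_zero hh.integrable hh.integral_ne_zero
  refine (Submodule.eq_bot_iff _).mpr fun ψ hψ => hF.eq_zero_of_V_comm ht fun Y hY => ?_
  refine ext_inner_left ℂ fun φ => ?_
  have hX : ∀ a : ℝ, MeasurableSet ((fun x => x + a) '' Set.Ico (0 : ℝ) 1) := fun a => by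
    rw [Set.image_add_const_Ico]
    exact measurableSet_Ico
  have hae : ∀ (a : ℝ) (α β : L2R),
      (fun x => star (α x) * E ((fun x => x + a) '' Set.Ico 0 1) β x) =ᵐ[volume]
        fun x => h (x - a) * (star (α x) * β x) := by
    intro a α β
    filter_upwards [hh.apply_ae a β] with x hx
    rw [hx]
    ring
  -- Pairing this function with $h(\cdot-a)$ gives the matrix element of the commutator at `ψ`,
  -- which vanishes by `hψ`.
  have hw := key (fun x => star (φ x) * F Y ψ x - star ((F Y).adjoint φ x) * ψ x)
    ((integrable_star_mul _ _).sub (integrable_star_mul _ _)) fun a => by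
      simp_rw [mul_sub]
      rw [integral_sub ((integrable_star_mul _ _).congr (hae a _ _))
        ((integrable_star_mul _ _).congr (hae a _ _)), ← integral_congr_ae (hae a _ _),
        ← integral_congr_ae (hae a _ _), ← inner_L2R, ← inner_L2R,
        ContinuousLinearMap.adjoint_inner_left, ← inner_sub_right, hψ _ Y (hX a) hY,
        inner_zero_right]
  simp_rw [mul_sub] at hw
  rw [integral_sub (integrable_exp_mul_star_mul _ _ _) (integrable_exp_mul_star_mul _ _ _),
    ← inner_V, ← inner_V, ContinuousLinearMap.adjoint_inner_left] at hw
  exact sub_eq_zero.mp hw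


/-! ### The Weyl relations of the Fourier-Plancherel operator -/

theorem U_toLp (q : ℝ) (f : SchwartzMap ℝ ℂ) :
    U q (f.toLp 2) = (f.compSubConstCLM ℂ q).toLp 2 := by
  refine Lp.ext ?_
  filter_upwards [U_apply_ae q (f.toLp 2), comp_sub_ae (f.coeFn_toLp 2 volume) q,
    (f.compSubConstCLM ℂ q).coeFn_toLp 2 volume] with x h1 h2 h3
  rw [h1, h2, h3, SchwartzMap.compSubConstCLM_apply]

/-- The factor $-2\pi q$ comes from the kernel $e^{-2\pi i x\xi}$. -/
theorem fourier_compSubConst (q : ℝ) (f : SchwartzMap ℝ ℂ) (ξ : ℝ) :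
    FourierTransform.fourier (f.compSubConstCLM ℂ q) ξ =
      Complex.exp (Complex.I * (-2 * Real.pi * q : ℝ) * ξ) * FourierTransform.fourier f ξ := by
  have h := congrFun (VectorFourier.fourierIntegral_comp_add_right Real.fourierChar volume
    (innerₗ ℝ) f (-q)) ξ
  have e : Complex.exp (Complex.I * (-2 * Real.pi * q : ℝ) * ξ) =
      (Real.fourierChar (innerₗ ℝ (-q) ξ) : ℂ) := by
    rw [Real.fourierChar_apply]
    congr 1
    simp
    ring
  rw [e]
  exact h

/-- Both sides are continuous in `ψ`, so the identity extends from the dense Schwartz functions. -/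
theorem fourierTransform_U (q : ℝ) (ψ : L2R) :
    Lp.fourierTransformₗᵢ ℝ ℂ (U q ψ) =
      V (-2 * Real.pi * q) (Lp.fourierTransformₗᵢ ℝ ℂ ψ) := by
  refine DenseRange.induction_on
    (SchwartzMap.denseRange_toLpCLM (E := ℝ) (F := ℂ) (p := 2) (μ := volume)
      ENNReal.ofNat_ne_top) ψ
    (isClosed_eq (by fun_prop) (by fun_prop)) fun f => ?_
  change FourierTransform.fourier (U q (f.toLp 2)) =
    V (-2 * Real.pi * q) (FourierTransform.fourier (f.toLp 2))
  rw [U_toLp, SchwartzMap.toLp_fourier_eq, SchwartzMap.toLp_fourier_eq]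
  refine Lp.ext ?_
  filter_upwards [V_apply_ae (-2 * Real.pi * q) ((FourierTransform.fourier f).toLp 2),
    (FourierTransform.fourier f).coeFn_toLp 2 volume,
    (FourierTransform.fourier (f.compSubConstCLM ℂ q)).coeFn_toLp 2 volume] with x h1 h2 h3
  rw [h1, h2, h3, fourier_compSubConst]

theorem fourierInv_compSubConst (q : ℝ) (f : SchwartzMap ℝ ℂ) (ξ : ℝ) :
    FourierTransform.fourierInv (f.compSubConstCLM ℂ q) ξ =
      Complex.exp (Complex.I * (2 * Real.pi * q : ℝ) * ξ) * FourierTransform.fourierInv f ξ := by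
  have hneg : ∀ g : SchwartzMap ℝ ℂ,
      FourierTransform.fourierInv g ξ = FourierTransform.fourier g (-ξ) := fun g => by
    rw [SchwartzMap.fourierInv_coe, Real.fourierInv_eq_fourier_neg, SchwartzMap.fourier_coe]
  rw [hneg, hneg, fourier_compSubConst]
  congr 2
  push_cast
  ring

theorem fourierTransform_symm_U (q : ℝ) (ψ : L2R) :
    (Lp.fourierTransformₗᵢ ℝ ℂ).symm (U q ψ) =
      V (2 * Real.pi * q) ((Lp.fourierTransformₗᵢ ℝ ℂ).symm ψ) := by
  refine DenseRange.induction_on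
    (SchwartzMap.denseRange_toLpCLM (E := ℝ) (F := ℂ) (p := 2) (μ := volume)
      ENNReal.ofNat_ne_top) ψ
    (isClosed_eq (by fun_prop) (by fun_prop)) fun f => ?_
  change FourierTransform.fourierInv (U q (f.toLp 2)) =
    V (2 * Real.pi * q) (FourierTransform.fourierInv (f.toLp 2))
  rw [U_toLp, SchwartzMap.toLp_fourierInv_eq, SchwartzMap.toLp_fourierInv_eq]
  refine Lp.ext ?_
  filter_upwards [V_apply_ae (2 * Real.pi * q) ((FourierTransform.fourierInv f).toLp 2),
    (FourierTransform.fourierInv f).coeFn_toLp 2 volume,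
    (FourierTransform.fourierInv (f.compSubConstCLM ℂ q)).coeFn_toLp 2 volume] with x h1 h2 h3
  rw [h1, h2, h3, fourierInv_compSubConst]

/-- This is the translation rule for the inverse transform, read backwards. -/
theorem fourierTransform_V (p : ℝ) (ψ : L2R) :
    Lp.fourierTransformₗᵢ ℝ ℂ (V p ψ) =
      U (p / (2 * Real.pi)) (Lp.fourierTransformₗᵢ ℝ ℂ ψ) := by
  rw [← LinearIsometryEquiv.eq_symm_apply, fourierTransform_symm_U,
    LinearIsometryEquiv.symm_apply_apply, mul_div_cancel₀ p Real.two_pi_pos.ne']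

/-! ### Smeared position and momentum observables -/

/-- The scale `c` covers both cases: $c=1$ for position, and $c=2\pi$ for momentum on the Fourier
side. -/
theorem isObservable_mulOp_smear (ρ : Measure ℝ) [IsProbabilityMeasure ρ] (c : ℝ) :
    IsObservable fun X => mulOp fun x => smear ρ X (c * x) where
  positive X hX := by
    refine (ContinuousLinearMap.isPositive_iff_complex _).mpr fun ψ => ?_
    have h : inner ℂ (mulOp (fun x => smear ρ X (c * x)) ψ) ψ =
        ((∫ x, ρ.real ((fun y => y - c * x) '' X) * ‖ψ x‖ ^ 2 : ℝ) : ℂ) := by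
      rw [inner_L2R, ← integral_complex_ofReal]
      refine integral_congr_ae ?_
      filter_upwards [mulOp_apply_ae (memLp_smear ρ hX) ψ] with x hx
      rw [hx, star_mul', smear, RCLike.star_def, Complex.conj_ofReal, mul_assoc, Complex.conj_mul']
      push_cast
      rfl
    rw [h]
    refine ⟨by simp, ?_⟩
    simp only [RCLike.re_to_complex, Complex.ofReal_re]
    exact integral_nonneg fun x => by positivity
  normalized := by
    ext1 ψ
    refine Lp.ext ?_
    filter_upwards [mulOp_apply_ae (memLp_smear ρ (c := c) .univ) ψ] with x hx
    have : (fun y => y - c * x) '' Set.univ = Set.univ :=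
      Set.image_univ_of_surjective (Equiv.subRight (c * x)).surjective
    rw [hx, smear, this]
    simp
  sigma_additive X hX hd φ ψ := by
    have hpre : ∀ (S : Set ℝ) (q : ℝ), (fun y => y - q) '' S = (fun y => y + q) ⁻¹' S := by
      intro S q
      ext y
      simp [sub_eq_iff_eq_add]
    have hsm : ∀ q, HasSum (fun n => ρ.real ((fun y => y - q) '' X n))
        (ρ.real ((fun y => y - q) '' ⋃ n, X n)) := by
      intro q
      simp_rw [hpre, Set.preimage_iUnion]
      have := hasSum_integral_iUnion (μ := ρ) (f := fun _ => (1 : ℝ))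
        (s := fun n => (fun y => y + q) ⁻¹' X n)
        (fun n => (measurable_add_const q) (hX n))
        (fun m n hmn => (hd hmn).preimage _) (integrable_const _).integrableOn
      simpa using this
    have hin : ∀ S, MeasurableSet S →
        (fun x => star (φ x) * mulOp (fun x => smear ρ S (c * x)) ψ x) =ᵐ[volume]
          fun x => smear ρ S (c * x) * (star (φ x) * ψ x) := by
      intro S hS
      filter_upwards [mulOp_apply_ae (memLp_smear ρ hS) ψ] with x hx
      rw [hx]
      ring
    simp_rw [inner_L2R]
    rw [integral_congr_ae (hin _ (.iUnion hX))]
    simp_rw [fun n => integral_congr_ae (hin _ (hX n))]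
    -- Each term is dominated by its own modulus; by additivity of `ρ` these bounds sum to the
    -- modulus of the integrand for the union.
    refine hasSum_integral_of_dominated_convergence
      (fun n x => ρ.real ((fun y => y - c * x) '' X n) * ‖star (φ x) * ψ x‖)
      (fun n => (integrable_star_mul _ _).congr (hin _ (hX n)) |>.aestronglyMeasurable)
      (fun n => .of_forall fun x => ?_) (.of_forall fun x => (hsm _).summable.mul_right _)
      ?_ (.of_forall fun x => ?_)
    · rw [norm_mul, smear, Complex.norm_real, Real.norm_of_nonneg measureReal_nonneg]
    · have h := ((integrable_star_mul _ _).congr (hin _ (.iUnion hX))).norm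
      refine h.congr (.of_forall fun x => ?_)
      dsimp only
      rw [tsum_mul_right, (hsm _).tsum_eq, norm_mul, smear, Complex.norm_real,
        Real.norm_of_nonneg measureReal_nonneg]
    · exact (Complex.hasSum_ofReal.mpr (hsm _)).mul_right _

theorem IsObservable.conj_isometryEquiv {Ω H : Type*} [MeasurableSpace Ω] [NormedAddCommGroup H]
    [InnerProductSpace ℂ H] [CompleteSpace H] {E : Set Ω → H →L[ℂ] H} (hE : IsObservable E)
    (W : H ≃ₗᵢ[ℂ] H) :
    IsObservable fun X => W.symm.toContinuousLinearEquiv.toContinuousLinearMap ∘L E X ∘L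
      W.toContinuousLinearEquiv.toContinuousLinearMap where
  positive X hX := by
    refine (ContinuousLinearMap.isPositive_iff_complex _).mpr fun ψ => ?_
    have h : inner ℂ ((W.symm.toContinuousLinearEquiv.toContinuousLinearMap ∘L E X ∘L
        W.toContinuousLinearEquiv.toContinuousLinearMap) ψ) ψ = inner ℂ (E X (W ψ)) (W ψ) :=
      W.symm.inner_map_eq_flip _ _
    rw [h]
    exact (ContinuousLinearMap.isPositive_iff_complex _).mp (hE.positive X hX) (W ψ)
  normalized := by
    ext1 ψ
    simp [hE.normalized]
  sigma_additive X hX hd φ ψ := by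
    have h : ∀ S, inner ℂ φ ((W.symm.toContinuousLinearEquiv.toContinuousLinearMap ∘L E S ∘L
        W.toContinuousLinearEquiv.toContinuousLinearMap) ψ) = inner ℂ (W φ) (E S (W ψ)) :=
      fun S => (W.inner_map_eq_flip φ (E S (W ψ))).symm
    simp_rw [h]
    exact hE.sigma_additive X hX hd _ _

theorem smear_image_add (ρ : Measure ℝ) (X : Set ℝ) (a q : ℝ) :
    smear ρ ((fun x => x + a) '' X) q = smear ρ X (q - a) := by
  simp only [smear, Set.image_image]
  congr 4
  ext x
  ring

theorem measurableSet_image_add {X : Set ℝ} (hX : MeasurableSet X) (a : ℝ) :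
    MeasurableSet ((fun x => x + a) '' X) :=
  (measurableEmbedding_addRight a).measurableSet_image.mpr hX

/-- Translating by `q` moves the smeared effect of `X` to that of `X + c q`. -/
theorem U_mulOp_smear (ρ : Measure ℝ) [IsProbabilityMeasure ρ] {X : Set ℝ} (hX : MeasurableSet X)
    (c q : ℝ) (ψ : L2R) :
    U q (mulOp (fun x => smear ρ X (c * x)) ψ) =
      mulOp (fun x => smear ρ ((fun x => x + c * q) '' X) (c * x)) (U q ψ) := by
  refine Lp.ext ?_
  filter_upwards [U_apply_ae q (mulOp (fun x => smear ρ X (c * x)) ψ), U_apply_ae q ψ,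
    comp_sub_ae (mulOp_apply_ae (memLp_smear ρ hX) ψ) q,
    mulOp_apply_ae (memLp_smear ρ (measurableSet_image_add hX (c * q))) (U q ψ)] with x h1 h2 h3 h4
  rw [h1, h3, h4, h2, smear_image_add, mul_sub]

theorem V_mulOp {f : ℝ → ℂ} (hf : MemLp f ∞ volume) (p : ℝ) (ψ : L2R) :
    V p (mulOp f ψ) = mulOp f (V p ψ) := by
  refine Lp.ext ?_
  filter_upwards [V_apply_ae p (mulOp f ψ), V_apply_ae p ψ, mulOp_apply_ae hf ψ,
    mulOp_apply_ae hf (V p ψ)] with x h1 h2 h3 h4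
  rw [h1, h3, h4, h2]
  ring

theorem isPositionObservable_positionObs (ρ : Measure ℝ) [IsProbabilityMeasure ρ] :
    IsPositionObservable (positionObs ρ) where
  observable := by simpa [positionObs] using! isObservable_mulOp_smear ρ 1
  covariant q X hX := U_conj_eq_iff.mpr fun ψ => by
    simpa [positionObs] using! U_mulOp_smear ρ hX 1 q ψ
  invariant p X hX := V_conj_eq_iff.mpr fun ψ =>
    V_mulOp (by simpa using memLp_smear ρ hX (c := 1)) p ψ

theorem momentumObs_apply (ν : Measure ℝ) (Y : Set ℝ) (ψ : L2R) :
    Lp.fourierTransformₗᵢ ℝ ℂ (momentumObs ν Y ψ) =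
      mulOp (fun ξ => smear ν Y (2 * Real.pi * ξ)) (Lp.fourierTransformₗᵢ ℝ ℂ ψ) :=
  (Lp.fourierTransformₗᵢ ℝ ℂ).apply_symm_apply _

theorem isMomentumObservable_momentumObs (ν : Measure ℝ) [IsProbabilityMeasure ν] :
    IsMomentumObservable (momentumObs ν) where
  observable :=
    (isObservable_mulOp_smear ν (2 * Real.pi)).conj_isometryEquiv (Lp.fourierTransformₗᵢ ℝ ℂ)
  covariant p Y hY := V_conj_eq_iff.mpr fun ψ => by
    apply (Lp.fourierTransformₗᵢ ℝ ℂ).injective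
    -- On the Fourier side the boost is translation by $p/2\pi$, and the scale $2\pi$ turns this
    -- into a shift of `Y` by exactly $p$.
    rw [fourierTransform_V, momentumObs_apply, momentumObs_apply, fourierTransform_V,
      U_mulOp_smear ν hY, mul_div_cancel₀ p Real.two_pi_pos.ne']
  invariant q Y hY := U_conj_eq_iff.mpr fun ψ => by
    apply (Lp.fourierTransformₗᵢ ℝ ℂ).injective
    rw [fourierTransform_U, momentumObs_apply, momentumObs_apply, fourierTransform_U,
      V_mulOp (memLp_smear ν hY)]

end PosMom

end

theorem mainTheorem6 :
    (∀ E F : Set ℝ → PosMom.L2R →L[ℂ] PosMom.L2R,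
      PosMom.IsPositionObservable E → PosMom.IsMomentumObservable F → PosMom.com E F = ⊥) ∧
    (∀ (ρ ν : MeasureTheory.Measure ℝ) [MeasureTheory.IsProbabilityMeasure ρ]
      [MeasureTheory.IsProbabilityMeasure ν],
      PosMom.com (PosMom.positionObs ρ) (PosMom.momentumObs ν) = ⊥) :=
  ⟨fun _ _ hE hF => PosMom.com_eq_bot hE hF, fun ρ ν _ _ =>
    PosMom.com_eq_bot (PosMom.isPositionObservable_positionObs ρ)
      (PosMom.isMomentumObservable_momentumObs ν)⟩
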